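/- Let $\mathbb{F}_q$ be a finite field, $l\ge 0$, $c\ge 1$, and let $\mathcal{Y}$ be a measurable space (discrete or continuous) on which the additive group $\mathbb{F}_q^l$ acts by measurable maps $(f_x)_{x\in\mathbb{F}_q^l}$. Let $W$ be a multiple access channel with $c$ senders, each with input alphabet $\mathbb{F}_q^l$, that is, a family of probability measures $W_{x_1,\ldots,x_c}$ on $\mathcal{Y}$. Suppose that $W$ is symmetric: for all $x_1,\ldots,x_c,x\in\mathbb{F}_q^l$ and all measurable $B\subset\mathcal{Y}$, $$W_{x_1,\ldots,x_c}(f_x(B))=W_{x_1+x,x_2,\ldots,x_c}(B)=\cdots=W_{x_1,\ldots,x_{c-1},x_c+x}(B).$$ Let $W_S$ be the single access channel $W_{S,x}:=W_{x,0,\ldots,0}$. A code for the modulo sum with $n$ uses of $W$ consists of a prime power $r$, an integer $k\ge 0$, independent stochastic encoders from $\mathbb{F}_r^{k}$ to $(\mathbb{F}_q^l)^n$, one for each sender, and a measurable decoder $\mathcal{Y}^n\to\mathbb{F}_r^{k}$. The messages $M_1,\ldots,M_c\in\mathbb{F}_r^{k}$ are independent and uniform; the error probability is the probability that the decoder does not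 output $M_1+\cdots+M_c$, and the leakage for a nonempty proper subset $J\subsetneq\{1,\ldots,c\}$ is the mutual information $I(\mathbf{Y};(M_i)_{i\in J})$ between the received block $\mathbf{Y}\in\mathcal{Y}^n$ and the messages of the senders in $J$. The secure modulo sum capacity $C_{\mathrm{SMS}}(W)$ is the supremum of $\limsup_{n\to\infty}\frac{k_n\log r}{n}$ over all prime powers $r$ and all sequences of such codes over $\mathbb{F}_r$ (one for every block length $n$, with $k=k_n$) whose error probability tends to $0$ and whose leakage tends to $0$ for every nonempty $J\subsetneq\{1,\ldots,c\}$. Then $$C_{\mathrm{SMS}}(W)=C(W_S),$$ where $C(W_S)$ is the channel capacity of the memoryless channel $W_S$: the supremum of $\limsup_{n\to\infty}\frac{\log |\mathcal{M}_n|}{n}$ over sequences of block codes with message sets $\mathcal{M}_n$ whose average error probability tends to $0$, which is also equal to $\sup_P I(P,W_S)$, the supremum over input distributions $P$ on $\mathbb{F}_q^l$ of the mutual information between the input and the output of $W_S$. -/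

import Mathlib

open MeasureTheory Filter Topology InformationTheory
open scoped ENNReal

noncomputable section

/-- The law of the output of the channel `V` when its input is drawn from `P`. -/
def mixture {A Y : Type*} [Fintype A] [MeasurableSpace Y]
    (P : PMF A) (V : A → Measure Y) : Measure Y :=
  ∑ a, P a • V a

/-- The mutual information `I(Z; Y)` (in nats) between an input `Z` with law `P` on a finite set and
the output `Y` of the channel `V`, that is `∑ a, P(a) D(V a ‖ ∑ b, P(b) V b)`. -/
def mutualInfo {A Y : Type*} [Fintype A] [MeasurableSpace Y]
    (P : PMF A) (V : A → Measure Y) : ℝ≥0∞ :=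
  ∑ a, P a * klDiv (V a) (mixture P V)

/-! ### Single access channels -/

/-- A deterministic block code with `M` messages for `n` uses of a channel with input alphabet `A`
and output alphabet `Y`. -/
structure ChannelCode (A Y : Type*) [MeasurableSpace Y] (n M : ℕ) where
  enc : Fin M → (Fin n → A)
  dec : (Fin n → Y) → Fin M
  measurableSet_dec : ∀ m, MeasurableSet (dec ⁻¹' {m})

/-- The average error probability of a block code over the memoryless extension of `V`. -/
def ChannelCode.error {A Y : Type*} [MeasurableSpace Y] {n M : ℕ}
    (Φ : ChannelCode A Y n M) (V : A → Measure Y) : ℝ≥0∞ :=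
  (M : ℝ≥0∞)⁻¹ * ∑ m, Measure.pi (fun t => V (Φ.enc m t)) {y | Φ.dec y ≠ m}

/-- The operational capacity of a memoryless channel: the supremum of the asymptotic rates
`(log M_n) / n` of block codes whose average error probability tends to `0`. -/
def channelCapacity {A Y : Type*} [MeasurableSpace Y] (V : A → Measure Y) : ℝ≥0∞ :=
  sSup {R | ∃ (M : ℕ → ℕ) (_ : ∀ n, 0 < M n) (Φ : ∀ n, ChannelCode A Y n (M n)),
    Tendsto (fun n => (Φ n).error V) atTop (𝓝 0) ∧
    R = limsup (fun n : ℕ => ENNReal.ofReal (Real.log (M n) / n)) atTop}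

/-- Shannon's expression for the capacity of a channel with finite input alphabet: the supremum over
all input distributions of the mutual information between input and output. -/
def informationCapacity {A Y : Type*} [Fintype A] [MeasurableSpace Y]
    (V : A → Measure Y) : ℝ≥0∞ :=
  ⨆ P : PMF A, mutualInfo P V

/-! ### Secure computation of modulo sums over a multiple access channel

A multiple access channel with `c` senders, input alphabet `X` for each of them and output alphabet
`Y` is a family `W : (Fin c → X) → Measure Y` of probability measures. -/

/-- A code for the transmission of the modulo sum of `c` messages in `F ^ k` with `n` channel uses:
a stochastic encoder for each sender and a decoder. -/
structure SumCode (F X Y : Type*) [MeasurableSpace Y] (c n k : ℕ) where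
  enc : Fin c → (Fin k → F) → PMF (Fin n → X)
  dec : (Fin n → Y) → (Fin k → F)
  measurableSet_dec : ∀ m, MeasurableSet (dec ⁻¹' {m})

namespace SumCode

variable {F X Y : Type*} [Fintype X] [MeasurableSpace Y] {c n k : ℕ}

/-- The law of the received block given that sender `i` encodes the message `m i`. The senders
randomize independently; if they send the blocks `x`, then the output symbols are independent and
the `t`-th one has law `W (x 0 t, …, x (c - 1) t)`. -/
def output (Φ : SumCode F X Y c n k) (W : (Fin c → X) → Measure Y)
    (m : Fin c → Fin k → F) : Measure (Fin n → Y) :=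
  ∑ x : Fin c → Fin n → X,
    (∏ i, Φ.enc i (m i) (x i)) • Measure.pi (fun t => W (fun i => x i t))

variable [Field F] [Fintype F]

/-- The probability that the decoder does not output the sum of the messages, which are independent
and uniform. -/
def error (Φ : SumCode F X Y c n k) (W : (Fin c → X) → Measure Y) : ℝ≥0∞ :=
  ∑ m, PMF.uniformOfFintype (Fin c → Fin k → F) m * Φ.output W m {y | Φ.dec y ≠ ∑ i, m i}

/-- The law of the received block given that the messages of the senders in `J` are `z`; the
messages of the other senders are independent of these and uniform. -/
def condOutput (Φ : SumCode F X Y c n k) (W : (Fin c → X) → Measure Y) (J : Finset (Fin c))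
    (z : J → Fin k → F) : Measure (Fin n → Y) :=
  mixture (PMF.uniformOfFintype (Fin c → Fin k → F))
    (fun m => Φ.output W (fun i => if h : i ∈ J then z ⟨i, h⟩ else m i))

/-- The information leaked to the receiver about the messages of the senders in `J`: the mutual
information between these messages and the received block. -/
def leakage (Φ : SumCode F X Y c n k) (W : (Fin c → X) → Measure Y)
    (J : Finset (Fin c)) : ℝ≥0∞ :=
  mutualInfo (PMF.uniformOfFintype (J → Fin k → F)) (Φ.condOutput W J)

end SumCode

/-- The secure modulo sum capacity: the supremum, over all finite fields `F` (that is, over all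
prime powers `q`) and all sequences of codes with vanishing error probability and vanishing leakage
about every nonempty proper subfamily of the messages, of the asymptotic rate `k_n log q / n`. -/
def secureModuloSumCapacity {c : ℕ} {X Y : Type*} [Fintype X] [MeasurableSpace Y]
    (W : (Fin c → X) → Measure Y) : ℝ≥0∞ :=
  sSup {R | ∃ (F : Type) (_ : Field F) (_ : Fintype F) (k : ℕ → ℕ)
      (Φ : ∀ n, SumCode F X Y c n (k n)),
    Tendsto (fun n => (Φ n).error W) atTop (𝓝 0) ∧
    (∀ J : Finset (Fin c), J.Nonempty → J ≠ Finset.univ →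
      Tendsto (fun n => (Φ n).leakage W J) atTop (𝓝 0)) ∧
    R = limsup (fun n : ℕ =>
      ENNReal.ofReal (k n * Real.log (Fintype.card F) / n)) atTop}

/-- The multiple access channel `W` with input alphabets `G` is symmetric for the action of `G` on
the output alphabet: `W_x (f_a (B))` is equal to `W_{x_1, …, x_i + a, …, x_c} (B)` for every `i`. -/
def IsSymmetricMAC {c : ℕ} {G Y : Type*} [AddGroup G] [AddAction G Y] [MeasurableSpace Y]
    (W : (Fin c → G) → Measure Y) : Prop :=
  ∀ (x : Fin c → G) (i : Fin c) (a : G) (B : Set Y), MeasurableSet B →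
    W x ((fun y => a +ᵥ y) '' B) = W (Function.update x i (x i + a)) B

/-- The single access channel `x ↦ W_{x, 0, …, 0}`. -/
def singleAccess {c : ℕ} [NeZero c] {G Y : Type*} [Zero G] [MeasurableSpace Y]
    (W : (Fin c → G) → Measure Y) (x : G) : Measure Y :=
  W (Pi.single 0 x)

end

/-! Write `V` for `singleAccess W`. Symmetry lets any input increment be moved to any sender, so `W
x = V (∑ i, x i)`: the receiver sees the channel `V` driven by the sum of the inputs
(`eq_singleAccess_sum`). Moreover the laws `V a` are translates of one another, and the output law
`κ` of uniform input is translation invariant. Hence D(V a ‖ κ) is the same number I for every a,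
and everything equals I through the cycle secure capacity ≤ capacity of `V` ≤ I ≤ secure capacity.

The first inequality (`secureModuloSumCapacity_le_channelCapacity`) ignores secrecy: freezing the
randomness of the encoders and all messages, up to a shift of one of them, turns a sum code into a
block code for `V`. The second (`channelCapacity_le`) compares each codeword's output law with the
product of copies of `κ`; by Chebyshev the information density is about nI uniformly in the
codeword.

The third (`le_secureModuloSumCapacity`) uses random affine codes, whose codewords are pairwise
independent and uniform. All senders use the same linear part, so the codewords add up to the
codeword of the sum of the messages. The receiver's law depends on that sum only, and the sum stays
uniform given the messages in a proper subset J: leakage is exactly zero without any local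
randomness.

Finally `mutualInfo_le_sum_klDiv` bounds every mutual information by I, and uniform input attains
it. -/

/-! ### Product measures and mixtures -/

open ProbabilityTheory in
theorem lintegral_pi_prod {ι Y : Type*} [Fintype ι] [MeasurableSpace Y] (μ : ι → Measure Y)
    [∀ i, IsProbabilityMeasure (μ i)] (f : ι → Y → ℝ≥0∞) (hf : ∀ i, Measurable (f i)) :
    ∫⁻ y, ∏ i, f i (y i) ∂Measure.pi μ = ∏ i, ∫⁻ y, f i y ∂μ i := by
  have h := iIndepFun_pi (μ := μ) (X := fun i => f i) (fun i => (hf i).aemeasurable)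
  have h2 := lintegral_prod_eq_prod_lintegral_of_indepFun Finset.univ
    (fun i (y : ι → Y) => f i (y i)) h (fun i => (hf i).comp (measurable_pi_apply i))
  refine h2.trans (Finset.prod_congr rfl fun i _ => ?_)
  exact (measurePreserving_eval μ i).lintegral_comp (hf i)

theorem pi_eq_withDensity_prod {ι Y : Type*} [Fintype ι] [MeasurableSpace Y] (μ ν : ι → Measure Y)
    [∀ i, IsProbabilityMeasure (μ i)] [∀ i, IsProbabilityMeasure (ν i)]
    (f : ι → Y → ℝ≥0∞) (hf : ∀ i, Measurable (f i)) (h : ∀ i, μ i = (ν i).withDensity (f i)) :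
    Measure.pi μ = (Measure.pi ν).withDensity (fun y => ∏ i, f i (y i)) := by
  refine Measure.pi_eq fun s hs => ?_
  rw [withDensity_apply _ (MeasurableSet.univ_pi hs), ← lintegral_indicator (MeasurableSet.univ_pi hs)]
  have : (Set.univ.pi s).indicator (fun y : ι → Y => ∏ i, f i (y i)) =
      fun y => ∏ i, (s i).indicator (f i) (y i) := by
    funext y
    by_cases hy : y ∈ Set.univ.pi s
    · rw [Set.indicator_of_mem hy]
      exact Finset.prod_congr rfl fun i _ => (Set.indicator_of_mem (hy i trivial) _).symm
    · rw [Set.indicator_of_notMem hy]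
      simp only [Set.mem_pi, Set.mem_univ, forall_const, not_forall] at hy
      obtain ⟨i, hi⟩ := hy
      exact (Finset.prod_eq_zero (Finset.mem_univ i) (Set.indicator_of_notMem hi _)).symm
  rw [this, lintegral_pi_prod _ _ fun i => (hf i).indicator (hs i)]
  refine Finset.prod_congr rfl fun i _ => ?_
  rw [lintegral_indicator (hs i), h i, withDensity_apply _ (hs i)]

theorem mixture_apply {A Y : Type*} [Fintype A] [MeasurableSpace Y] (P : PMF A) (V : A → Measure Y)
    (B : Set Y) : mixture P V B = ∑ a, P a * V a B := by
  simp [mixture]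

theorem PMF.sum_coe_fintype {A : Type*} [Fintype A] (P : PMF A) : ∑ a, P a = 1 := by
  rw [← tsum_fintype (L := .unconditional A), P.tsum_coe]

instance mixture.isProbabilityMeasure {A Y : Type*} [Fintype A] [MeasurableSpace Y] (P : PMF A)
    (V : A → Measure Y) [∀ a, IsProbabilityMeasure (V a)] : IsProbabilityMeasure (mixture P V) :=
  ⟨by simp [mixture_apply, P.sum_coe_fintype]⟩

theorem smul_le_mixture {A Y : Type*} [Fintype A] [MeasurableSpace Y] (P : PMF A)
    (V : A → Measure Y) (a : A) : P a • V a ≤ mixture P V := by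
  refine Measure.le_iff.2 fun s _ => ?_
  rw [mixture_apply]
  exact Finset.single_le_sum (f := fun a => P a * V a s) (fun _ _ => zero_le) (Finset.mem_univ a)

theorem le_inv_smul_mixture {A Y : Type*} [Fintype A] [MeasurableSpace Y] (P : PMF A)
    (V : A → Measure Y) {a : A} (ha : P a ≠ 0) : V a ≤ (P a)⁻¹ • mixture P V := by
  refine Measure.le_iff.2 fun s _ => ?_
  have := Measure.le_iff'.1 (smul_le_mixture P V a) s
  simp only [Measure.smul_apply, smul_eq_mul] at this ⊢
  calc V a s = (P a)⁻¹ * (P a * V a s) := by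
        rw [← mul_assoc, ENNReal.inv_mul_cancel ha (P.apply_ne_top a), one_mul]
    _ ≤ _ := by gcongr

/-- The average of the `n`-fold product channel over memoryless inputs is a product measure. -/
theorem sum_prod_mul_pi {A Y : Type*} [Fintype A] [MeasurableSpace Y] (P : PMF A)
    (V : A → Measure Y) [∀ a, IsProbabilityMeasure (V a)] (n : ℕ) (B : Set (Fin n → Y)) :
    ∑ x : Fin n → A, (∏ t, P (x t)) * Measure.pi (fun t => V (x t)) B =
      Measure.pi (fun _ => mixture P V) B := by
  classical
  have : Measure.pi (fun _ : Fin n => mixture P V) =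
      ∑ x : Fin n → A, (∏ t, P (x t)) • Measure.pi (fun t => V (x t)) := by
    refine Measure.pi_eq fun s _ => ?_
    simp only [Measure.finsetSum_apply, Measure.smul_apply, smul_eq_mul, Measure.pi_pi,
      mixture_apply, Finset.prod_univ_sum, Fintype.piFinset_univ, Finset.prod_mul_distrib]
  rw [this]
  simp

/-! ### Log-likelihood ratios and divergence -/

/-- Writing x log² x = 4 (√x log √x)² reduces this to continuity of t log t at 0 and compactness. -/
theorem exists_mul_log_sq_le (C : ℝ) : ∃ B, ∀ x ∈ Set.Icc 0 C, x * Real.log x ^ 2 ≤ B := by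
  have hc : ContinuousOn (fun x : ℝ => 4 * (√x * Real.log √x) ^ 2) (Set.Icc 0 C) := by
    have h := Real.continuous_mul_log.comp Real.continuous_sqrt
    exact (continuous_const.mul (h.pow 2)).continuousOn
  obtain ⟨B, hB⟩ := (isCompact_Icc.image_of_continuousOn hc).bddAbove
  refine ⟨B, fun x hx => le_trans (le_of_eq ?_) (hB ⟨x, hx, rfl⟩)⟩
  simp only
  rw [Real.log_sqrt hx.1, mul_pow, Real.sq_sqrt hx.1]
  ring

/-- With f the density, integrating the squared log-ratio against μ means integrating f log² f
against ν; this is bounded because f ≤ C. -/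
theorem memLp_llr_of_le_smul {Y : Type*} [MeasurableSpace Y] {μ ν : Measure Y}
    [IsProbabilityMeasure μ] [IsProbabilityMeasure ν] {C : ℝ≥0∞} (hC : C ≠ ∞) (h : μ ≤ C • ν) :
    MemLp (llr μ ν) 2 μ := by
  have hac : μ ≪ ν := Measure.absolutelyContinuous_of_le_smul h
  have hle : μ.rnDeriv ν ≤ᵐ[ν] fun _ => C := by
    refine ae_le_of_forall_setLIntegral_le_of_sigmaFinite (Measure.measurable_rnDeriv _ _) ?_
    intro s hs _
    rw [Measure.setLIntegral_rnDeriv hac, setLIntegral_const]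
    exact Measure.le_iff'.1 h s
  rw [memLp_two_iff_integrable_sq (measurable_llr μ ν).aestronglyMeasurable,
    ← integrable_toReal_rnDeriv_mul_iff hac]
  obtain ⟨B, hB⟩ := exists_mul_log_sq_le C.toReal
  refine Integrable.of_bound (C := B) ?_ ?_
  · exact ((Measure.measurable_rnDeriv _ _).ennreal_toReal.mul
      ((measurable_llr μ ν).pow_const 2)).aestronglyMeasurable
  · filter_upwards [hle] with y hy
    rw [Real.norm_of_nonneg (by positivity)]
    exact hB _ ⟨by positivity, ENNReal.toReal_mono hC hy⟩

theorem klDiv_ne_top_of_le_smul {Y : Type*} [MeasurableSpace Y] {μ ν : Measure Y}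
    [IsProbabilityMeasure μ] [IsProbabilityMeasure ν] {C : ℝ≥0∞} (hC : C ≠ ∞) (h : μ ≤ C • ν) :
    klDiv μ ν ≠ ∞ :=
  klDiv_ne_top (Measure.absolutelyContinuous_of_le_smul h)
    ((memLp_llr_of_le_smul hC h).integrable (by norm_num))

theorem toReal_klDiv_eq_integral_llr {Y : Type*} [MeasurableSpace Y] {μ ν : Measure Y}
    [IsProbabilityMeasure μ] [IsProbabilityMeasure ν] (h : μ ≪ ν) :
    (klDiv μ ν).toReal = ∫ y, llr μ ν y ∂μ :=
  toReal_klDiv_of_measure_eq h (by simp)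

theorem toReal_rnDeriv_pos {Y : Type*} [MeasurableSpace Y] {μ ν : Measure Y} [SigmaFinite μ]
    [SigmaFinite ν] (h : μ ≪ ν) : ∀ᵐ y ∂μ, 0 < (μ.rnDeriv ν y).toReal := by
  filter_upwards [Measure.rnDeriv_pos h, h.ae_le (Measure.rnDeriv_lt_top μ ν)] with y h1 h2
  exact ENNReal.toReal_pos h1.ne' h2.ne

theorem llr_add_llr {Y : Type*} [MeasurableSpace Y] {μ ν κ : Measure Y} [IsProbabilityMeasure μ]
    [IsProbabilityMeasure ν] [IsProbabilityMeasure κ] (hμν : μ ≪ ν) (hνκ : ν ≪ κ) :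
    llr μ κ =ᵐ[μ] fun y => llr μ ν y + llr ν κ y := by
  have h1 := (hμν.trans hνκ).ae_le (Measure.rnDeriv_mul_rnDeriv (κ := κ) hμν)
  filter_upwards [h1, toReal_rnDeriv_pos hμν, toReal_rnDeriv_pos (hμν.trans hνκ)]
    with y hy h2 h3
  rw [llr, llr, llr, ← hy, Pi.mul_apply, ENNReal.toReal_mul, Real.log_mul h2.ne']
  rintro h0
  rw [← hy, Pi.mul_apply, ENNReal.toReal_mul, h0, mul_zero] at h3
  exact h3.false

/-- The output law of a channel is the measure with the least average divergence. -/
theorem mutualInfo_le_sum_klDiv {A Y : Type*} [Fintype A] [MeasurableSpace Y] (P : PMF A)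
    (V : A → Measure Y) [∀ a, IsProbabilityMeasure (V a)] (κ : Measure Y) [IsProbabilityMeasure κ]
    {C : ℝ≥0∞} (hC : C ≠ ∞) (h : ∀ a, V a ≤ C • κ) :
    mutualInfo P V ≤ ∑ a, P a * klDiv (V a) κ := by
  set ν := mixture P V with hν
  have hνκ : ν ≤ C • κ := by
    refine Measure.le_iff.2 fun s _ => ?_
    rw [hν, mixture_apply]
    calc ∑ a, P a * V a s ≤ ∑ a, P a * (C • κ) s := by
          gcongr with a; exact h a
      _ = (C • κ) s := by rw [← Finset.sum_mul, P.sum_coe_fintype, one_mul]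
  have hνac : ν ≪ κ := Measure.absolutelyContinuous_of_le_smul hνκ
  have hint : Integrable (llr ν κ) ν := (memLp_llr_of_le_smul hC hνκ).integrable (by norm_num)
  have hfin : ∀ a, P a * klDiv (V a) κ ≠ ∞ := fun a =>
    ENNReal.mul_ne_top (P.apply_ne_top a) (klDiv_ne_top_of_le_smul hC (h a))
  have hfin' : ∀ a, P a * klDiv (V a) ν ≠ ∞ := fun a => by
    by_cases ha : P a = 0
    · simp [ha]
    · exact ENNReal.mul_ne_top (P.apply_ne_top a) (klDiv_ne_top_of_le_smul
        (ENNReal.inv_ne_top.2 ha) (le_inv_smul_mixture P V ha))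
  have hint' : ∀ a, Integrable (llr ν κ) (P a • V a) := fun a =>
    hint.mono_measure (smul_le_mixture P V a)
  -- Inputs of positive probability satisfy V a ≪ ν ≪ κ, so the log-densities add up.
  have key : ∀ a, (P a * klDiv (V a) κ).toReal =
      (P a * klDiv (V a) ν).toReal + ∫ y, llr ν κ y ∂(P a • V a) := fun a => by
    by_cases ha : P a = 0
    · simp [ha]
    have hle := le_inv_smul_mixture P V ha
    have hac : V a ≪ ν := Measure.absolutelyContinuous_of_le_smul hle
    have hi : Integrable (llr ν κ) (V a) := by
      have := hint' a
      rwa [integrable_smul_measure ha (P.apply_ne_top a)] at this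
    rw [ENNReal.toReal_mul, ENNReal.toReal_mul, toReal_klDiv_eq_integral_llr (hac.trans hνac),
      toReal_klDiv_eq_integral_llr hac, integral_congr_ae (llr_add_llr hac hνac),
      integral_add ((memLp_llr_of_le_smul (ENNReal.inv_ne_top.2 ha) hle).integrable (by norm_num))
        hi, integral_smul_measure, smul_eq_mul, mul_add]
  rw [mutualInfo, ← ENNReal.toReal_le_toReal (ENNReal.sum_ne_top.2 fun a _ => hfin' a)
    (ENNReal.sum_ne_top.2 fun a _ => hfin a), ENNReal.toReal_sum fun a _ => hfin' a,
    ENNReal.toReal_sum fun a _ => hfin a, Finset.sum_congr rfl fun a _ => key a,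
    Finset.sum_add_distrib, ← integral_finsetSum_measure fun a _ => hint' a]
  -- The surplus is the divergence of ν from κ.
  have : 0 ≤ ∫ y, llr ν κ y ∂∑ a, P a • V a := by
    change 0 ≤ ∫ y, llr ν κ y ∂ν
    rw [← toReal_klDiv_eq_integral_llr hνac]
    positivity
  linarith

open ProbabilityTheory in
/-- The weak law of large numbers for the information density, uniformly in the input block. -/
theorem exists_measure_llr_deviation_le {A Y : Type*} [Fintype A] [MeasurableSpace Y]
    (V : A → Measure Y) [∀ a, IsProbabilityMeasure (V a)] (κ : Measure Y) [IsProbabilityMeasure κ]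
    {C : ℝ≥0∞} (hC : C ≠ ∞) (h : ∀ a, V a ≤ C • κ) {I : ℝ} (hI : ∀ a, (klDiv (V a) κ).toReal = I) :
    ∃ c : ℝ, ∀ (n : ℕ) (x : Fin n → A) (δ : ℝ), 0 < n → 0 < δ →
      Measure.pi (fun t => V (x t)) {y | n * δ ≤ |∑ t, llr (V (x t)) κ (y t) - n * I|} ≤
        ENNReal.ofReal (c / (n * δ ^ 2)) := by
  have hL : ∀ a, MemLp (llr (V a) κ) 2 (V a) := fun a => memLp_llr_of_le_smul hC (h a)
  refine ⟨∑ a, Var[llr (V a) κ; V a], fun n x δ hn hδ => ?_⟩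
  have hn' : (0 : ℝ) < n := by exact_mod_cast hn
  have hLx : ∀ t : Fin n, MemLp (fun y : Fin n → Y => llr (V (x t)) κ (y t)) 2
      (Measure.pi fun t => V (x t)) := fun t =>
    (hL (x t)).comp_measurePreserving (measurePreserving_eval (fun t => V (x t)) t)
  have hmean : (Measure.pi fun t => V (x t))[∑ t, fun y : Fin n → Y => llr (V (x t)) κ (y t)] =
      n * I := by
    simp only [Finset.sum_apply]
    rw [integral_finsetSum _ fun t _ => (hLx t).integrable (by norm_num)]
    have : ∀ t : Fin n, ∫ y, llr (V (x t)) κ (y t) ∂(Measure.pi fun t => V (x t)) = I := fun t => by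
      rw [← hI (x t), toReal_klDiv_eq_integral_llr (Measure.absolutelyContinuous_of_le_smul (h _)),
        ← (measurePreserving_eval (fun t => V (x t)) t).map_eq, integral_map
          (measurable_pi_apply t).aemeasurable (measurable_llr _ _).aestronglyMeasurable]
    simp [this]
  have hch := meas_ge_le_variance_div_sq (memLp_finsetSum' Finset.univ fun t _ => hLx t)
    (mul_pos hn' hδ)
  rw [hmean, variance_sum_pi fun t => hL (x t)] at hch
  simp only [Finset.sum_apply] at hch
  refine hch.trans (ENNReal.ofReal_le_ofReal ?_)
  -- Bounding each variance by the sum over the whole alphabet makes the constant independent of the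
  -- block.
  have hsum : ∑ t, Var[llr (V (x t)) κ; V (x t)] ≤ n * ∑ a, Var[llr (V a) κ; V a] := by
    calc _ ≤ ∑ _t : Fin n, ∑ a, Var[llr (V a) κ; V a] := by
          gcongr with t
          exact Finset.single_le_sum (f := fun a => Var[llr (V a) κ; V a])
            (fun a _ => variance_nonneg _ _) (Finset.mem_univ (x t))
      _ = _ := by simp
  rw [div_le_div_iff₀ (by positivity) (by positivity)]
  calc _ ≤ (n * ∑ a, Var[llr (V a) κ; V a]) * (n * δ ^ 2) := by gcongr
    _ = _ := by ring

/-! ### Block densities and the one-shot converse -/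

/-- The density of the output law of the block `x` with respect to the product of copies of `κ`. -/
noncomputable def blockDensity {A Y : Type*} [MeasurableSpace Y] (V : A → Measure Y) (κ : Measure Y)
    {n : ℕ} (x : Fin n → A) (y : Fin n → Y) : ℝ≥0∞ :=
  ∏ t, (V (x t)).rnDeriv κ (y t)

section BlockDensity

theorem measurable_blockDensity {A Y : Type*} [MeasurableSpace Y] (V : A → Measure Y)
    (κ : Measure Y) {n : ℕ} (x : Fin n → A) : Measurable (blockDensity V κ x) :=
  Finset.measurable_prod _ fun t _ =>
    (Measure.measurable_rnDeriv (V (x t)) κ).comp (measurable_pi_apply t)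

variable {A Y : Type*} [MeasurableSpace Y] {V : A → Measure Y} [∀ a, IsProbabilityMeasure (V a)]
  {κ : Measure Y} [IsProbabilityMeasure κ] {n : ℕ}

theorem pi_eq_withDensity_blockDensity (h : ∀ a, V a ≪ κ) (x : Fin n → A) :
    Measure.pi (fun t => V (x t)) =
      (Measure.pi fun _ => κ).withDensity (blockDensity V κ x) :=
  pi_eq_withDensity_prod _ _ _ (fun _ => Measure.measurable_rnDeriv _ _)
    fun t => (Measure.withDensity_rnDeriv_eq _ _ (h (x t))).symm

theorem blockDensity_eq_exp_sum_llr (h : ∀ a, V a ≪ κ) (x : Fin n → A) :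
    ∀ᵐ y ∂Measure.pi (fun t => V (x t)),
      blockDensity V κ x y = ENNReal.ofReal (Real.exp (∑ t, llr (V (x t)) κ (y t))) := by
  have h1 : ∀ᵐ y ∂Measure.pi (fun t => V (x t)), ∀ t, 0 < ((V (x t)).rnDeriv κ (y t)).toReal :=
    ae_all_iff.2 fun t => (measurePreserving_eval (fun t => V (x t)) t).quasiMeasurePreserving.ae
      (toReal_rnDeriv_pos (h (x t)))
  filter_upwards [h1] with y hy
  rw [Real.exp_sum, ENNReal.ofReal_prod_of_nonneg fun _ _ => (Real.exp_pos _).le, blockDensity]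
  refine Finset.prod_congr rfl fun t _ => ?_
  rw [llr, Real.exp_log (hy t), ENNReal.ofReal_toReal]
  exact fun h0 => by simpa [h0] using hy t

theorem measure_lt_blockDensity_le_inv (h : ∀ a, V a ≪ κ) (x : Fin n → A) {γ : ℝ≥0∞} (hγ : γ ≠ 0)
    (hγ' : γ ≠ ∞) : Measure.pi (fun _ => κ) {y | γ < blockDensity V κ x y} ≤ γ⁻¹ := by
  calc _ ≤ Measure.pi (fun _ => κ) {y | γ ≤ blockDensity V κ x y} :=
        measure_mono fun y (hy : γ < _) => hy.le
    _ ≤ (∫⁻ y, blockDensity V κ x y ∂Measure.pi fun _ => κ) / γ :=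
        meas_ge_le_lintegral_div (measurable_blockDensity V κ x).aemeasurable hγ hγ'
    _ = γ⁻¹ := by
        rw [← setLIntegral_univ, ← withDensity_apply _ MeasurableSet.univ,
          ← pi_eq_withDensity_blockDensity h x, measure_univ, one_div]

/-- A block code with small error probability has few messages if the block densities are small with
high probability. -/
theorem one_le_error_add {M : ℕ} (hM : 0 < M) (Φ : ChannelCode A Y n M) (h : ∀ a, V a ≪ κ)
    {γ τ : ℝ≥0∞}
    (hτ : ∀ x : Fin n → A, Measure.pi (fun t => V (x t)) {y | γ < blockDensity V κ x y} ≤ τ) :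
    1 ≤ Φ.error V + τ + γ * (M : ℝ≥0∞)⁻¹ := by
  have hM0 : (M : ℝ≥0∞) ≠ 0 := by exact_mod_cast hM.ne'
  have hMt : (M : ℝ≥0∞) ≠ ∞ := ENNReal.natCast_ne_top M
  have key : ∀ m, 1 ≤ Measure.pi (fun t => V (Φ.enc m t)) {y | Φ.dec y ≠ m} + τ +
      γ * Measure.pi (fun _ => κ) (Φ.dec ⁻¹' {m}) := fun m => by
    set E := {y | γ < blockDensity V κ (Φ.enc m) y} with hE
    have hEm : MeasurableSet E := measurableSet_lt measurable_const (measurable_blockDensity V κ _)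
    have hcover : (Set.univ : Set (Fin n → Y)) ⊆
        {y | Φ.dec y ≠ m} ∪ E ∪ (Φ.dec ⁻¹' {m} ∩ Eᶜ) := fun y _ => by
      by_cases h1 : Φ.dec y = m <;> by_cases h2 : y ∈ E <;> simp [h1, h2]
    have hlast : Measure.pi (fun t => V (Φ.enc m t)) (Φ.dec ⁻¹' {m} ∩ Eᶜ) ≤
        γ * Measure.pi (fun _ => κ) (Φ.dec ⁻¹' {m}) := by
      have hms := (Φ.measurableSet_dec m).inter hEm.compl
      rw [pi_eq_withDensity_blockDensity h, withDensity_apply _ hms]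
      calc _ ≤ ∫⁻ _ in Φ.dec ⁻¹' {m} ∩ Eᶜ, γ ∂Measure.pi (fun _ => κ) :=
            setLIntegral_mono' hms fun y hy => not_lt.1 hy.2
        _ ≤ _ := by
            rw [setLIntegral_const]
            gcongr
            exact Set.inter_subset_left
    calc (1 : ℝ≥0∞) = Measure.pi (fun t => V (Φ.enc m t)) Set.univ := measure_univ.symm
      _ ≤ _ := measure_mono hcover
      _ ≤ _ := measure_union_le _ _
      _ ≤ _ := add_le_add (measure_union_le _ _) hlast
      _ ≤ _ := by gcongr; exact hτ _
  -- The decoding regions partition the output space, so together they cost only γ.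
  have hpart : ∑ m, Measure.pi (fun _ => κ) (Φ.dec ⁻¹' {m}) = 1 := by
    rw [← measure_biUnion_finset (fun i _ j _ hij => Disjoint.preimage _ (by simpa using hij))
      fun m _ => Φ.measurableSet_dec m]
    convert measure_univ (μ := Measure.pi fun _ : Fin n => κ)
    ext y; simp
  have hsum := Finset.sum_le_sum fun m (_ : m ∈ Finset.univ) => key m
  simp only [Finset.sum_add_distrib, ← Finset.mul_sum, hpart, Finset.sum_const, Finset.card_univ,
    Fintype.card_fin, nsmul_eq_mul, mul_one] at hsum
  calc (1 : ℝ≥0∞) = (M : ℝ≥0∞)⁻¹ * M := (ENNReal.inv_mul_cancel hM0 hMt).symm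
    _ ≤ (M : ℝ≥0∞)⁻¹ *
        (∑ m, Measure.pi (fun t => V (Φ.enc m t)) {y | Φ.dec y ≠ m} + M * τ + γ) := by gcongr
    _ = _ := by
      rw [mul_add, mul_add, ← mul_assoc (M : ℝ≥0∞)⁻¹ M τ, ENNReal.inv_mul_cancel hM0 hMt, one_mul,
        mul_comm γ]
      rfl

end BlockDensity

/-! ### Concentration and the strong converse -/

section Asymptotics

variable {A Y : Type*} [Fintype A] [MeasurableSpace Y] {V : A → Measure Y}
  [∀ a, IsProbabilityMeasure (V a)] {κ : Measure Y} [IsProbabilityMeasure κ]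

/-- One null sequence serves all blocks x: the upper tail is needed for the converse, the lower tail
for random coding. -/
theorem exists_tail_bound {C : ℝ≥0∞} (hC : C ≠ ∞) (h : ∀ a, V a ≤ C • κ) {I : ℝ}
    (hI : ∀ a, (klDiv (V a) κ).toReal = I) {θ : ℝ} (hθ : θ ≠ I) :
    ∃ τ : ℕ → ℝ≥0∞, Tendsto τ atTop (𝓝 0) ∧ ∀ n, 0 < n → ∀ x : Fin n → A,
      (θ < I → Measure.pi (fun t => V (x t))
        {y | blockDensity V κ x y ≤ ENNReal.ofReal (Real.exp (n * θ))} ≤ τ n) ∧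
      (I < θ → Measure.pi (fun t => V (x t))
        {y | ENNReal.ofReal (Real.exp (n * θ)) < blockDensity V κ x y} ≤ τ n) := by
  obtain ⟨c, hc⟩ := exists_measure_llr_deviation_le V κ hC h hI
  have hac : ∀ a, V a ≪ κ := fun a => Measure.absolutelyContinuous_of_le_smul (h a)
  refine ⟨fun n => ENNReal.ofReal (c / (n * |θ - I| ^ 2)), ?_, fun n hn x => ⟨fun hlt => ?_,
    fun hlt => ?_⟩⟩
  · rw [← ENNReal.ofReal_zero]
    refine ENNReal.tendsto_ofReal (Tendsto.const_div_atTop ?_ c)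
    exact tendsto_natCast_atTop_atTop.atTop_mul_const (by have := sub_ne_zero.2 hθ; positivity)
  · refine le_trans (measure_mono_ae ?_) (hc n x _ hn (abs_pos.2 (sub_ne_zero.2 hθ)))
    filter_upwards [blockDensity_eq_exp_sum_llr hac x] with y hy (hy2 : _ ≤ _)
    rw [hy, ENNReal.ofReal_le_ofReal_iff (Real.exp_pos _).le, Real.exp_le_exp] at hy2
    change _ ≤ _
    rw [abs_sub_comm θ, abs_of_pos (sub_pos.2 hlt), abs_sub_comm]
    exact le_trans (by linarith) (le_abs_self _)
  · refine le_trans (measure_mono_ae ?_) (hc n x _ hn (abs_pos.2 (sub_ne_zero.2 hθ)))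
    filter_upwards [blockDensity_eq_exp_sum_llr hac x] with y hy (hy2 : _ < _)
    rw [hy, ENNReal.ofReal_lt_ofReal_iff (Real.exp_pos _), Real.exp_lt_exp] at hy2
    change _ ≤ _
    rw [abs_of_pos (sub_pos.2 hlt)]
    exact le_trans (by linarith) (le_abs_self _)

/-- The strong converse for a channel whose divergences from `κ` are all equal to `I`. -/
theorem channelCapacity_le {C : ℝ≥0∞} (hC : C ≠ ∞) (h : ∀ a, V a ≤ C • κ) {I : ℝ}
    (hI : ∀ a, (klDiv (V a) κ).toReal = I) : channelCapacity V ≤ ENNReal.ofReal I := by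
  have hac : ∀ a, V a ≪ κ := fun a => Measure.absolutelyContinuous_of_le_smul (h a)
  refine sSup_le ?_
  rintro R ⟨M, hM, Φ, herr, rfl⟩
  have hlim : ∀ θ, I < θ →
      limsup (fun n : ℕ => ENNReal.ofReal (Real.log (M n) / n)) atTop ≤ ENNReal.ofReal θ := by
    intro θ hθ
    obtain ⟨θ', hθ1, hθ2⟩ := exists_between hθ
    obtain ⟨τ, hτ, hτb⟩ := exists_tail_bound hC h hI hθ1.ne'
    refine limsup_le_of_le (h := ?_)
    have hq : (0 : ℝ≥0∞) < 4⁻¹ := by simp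
    have hlog : Tendsto (fun n : ℕ => Real.log 2 / n) atTop (𝓝 0) :=
      tendsto_const_div_atTop_nhds_zero_nat _
    filter_upwards [herr.eventually (gt_mem_nhds hq), hτ.eventually (gt_mem_nhds hq),
      eventually_gt_atTop 0, hlog.eventually (gt_mem_nhds (sub_pos.2 hθ2))] with n h1 h2 hn h3
    have hn' : (0 : ℝ) < n := by exact_mod_cast hn
    have hMn : (0 : ℝ) < M n := by exact_mod_cast hM n
    have hone := one_le_error_add (hM n) (Φ n) hac fun x => (hτb n hn x).2 hθ1
    -- Error and tail are each below 1/4, so the last term of the one-shot bound carries at least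
    -- 1/2; this gives M ≤ 2 exp(nθ').
    have hhalf : ENNReal.ofReal (1 / 2) ≤
        ENNReal.ofReal (Real.exp (n * θ')) * (M n : ℝ≥0∞)⁻¹ := by
      by_contra! hlt
      have h4 : (4⁻¹ : ℝ≥0∞) = ENNReal.ofReal (1 / 4) := by
        rw [one_div, ENNReal.ofReal_inv_of_pos (by norm_num)]; norm_num
      have := ENNReal.add_lt_add (ENNReal.add_lt_add h1 h2) hlt
      rw [h4, ← ENNReal.ofReal_add (by norm_num) (by norm_num),
        ← ENNReal.ofReal_add (by norm_num) (by norm_num)] at this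
      norm_num at this
      exact absurd (hone.trans_lt this) (lt_irrefl _)
    rw [← ENNReal.ofReal_natCast, ← ENNReal.ofReal_inv_of_pos hMn,
      ← ENNReal.ofReal_mul (Real.exp_pos _).le, ENNReal.ofReal_le_ofReal_iff (by positivity),
      ← div_eq_mul_inv, le_div_iff₀ hMn] at hhalf
    have hMle : (M n : ℝ) ≤ 2 * Real.exp (n * θ') := by linarith
    have hlogM := Real.log_le_log hMn hMle
    rw [Real.log_mul (by norm_num) (Real.exp_pos _).ne', Real.log_exp] at hlogM
    refine ENNReal.ofReal_le_ofReal ?_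
    calc Real.log (M n) / n ≤ (Real.log 2 + n * θ') / n := by gcongr
      _ = Real.log 2 / n + θ' := by field_simp
      _ ≤ θ := by linarith
  refine ge_of_tendsto (x := 𝓝[>] I) (f := fun θ => ENNReal.ofReal θ)
    (ENNReal.continuous_ofReal.tendsto I |>.mono_left nhdsWithin_le_nhds) ?_
  exact eventually_nhdsWithin_of_forall hlim

end Asymptotics

/-! ### Averaging over translations -/

section Averaging

variable {D A : Type*} [Fintype D] [AddGroup D] [Fintype A]

theorem card_mul_sum_eq_sum_sum_shift (f : D → ℝ≥0∞) (j : A → D) :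
    (Fintype.card A : ℝ≥0∞) * ∑ d, f d = ∑ d, ∑ a, f (d + j a) := by
  rw [Finset.sum_comm]
  have : ∀ a, ∑ d, f (d + j a) = ∑ d, f d := fun a => Equiv.sum_comp (Equiv.addRight (j a)) f
  simp [this]

theorem exists_le_sum_mul {ι : Type*} [Fintype ι] [Nonempty ι] (w f : ι → ℝ≥0∞)
    (hw : ∑ i, w i = 1) : ∃ i, f i ≤ ∑ i, w i * f i := by
  obtain ⟨i, hi⟩ := Finite.exists_min f
  refine ⟨i, ?_⟩
  calc f i = ∑ j, w j * f i := by rw [← Finset.sum_mul, hw, one_mul]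
    _ ≤ _ := by gcongr with j; exact hi j

/-- If one coordinate of a uniform random vector shifts the value of `σ`, then `σ` is uniform. -/
theorem sum_uniform_mul_comp {C A : Type*} [Fintype C] [AddGroup C] [Fintype A] [AddGroup A]
    (σ : C → A) (j : A → C) (hσ : ∀ m a, σ (m + j a) = σ m + a) (h : A → ℝ≥0∞) :
    ∑ m, PMF.uniformOfFintype C m * h (σ m) = (Fintype.card A : ℝ≥0∞)⁻¹ * ∑ a, h a := by
  have h1 := card_mul_sum_eq_sum_sum_shift (fun m => PMF.uniformOfFintype C m * h (σ m)) j
  have h2 : ∀ m, ∑ a, PMF.uniformOfFintype C (m + j a) * h (σ (m + j a)) =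
      PMF.uniformOfFintype C m * ∑ a, h a := fun m => by
    simp only [hσ, PMF.uniformOfFintype_apply, ← Finset.mul_sum]
    exact congrArg _ (Equiv.sum_comp (Equiv.addLeft (σ m)) h)
  simp only [h2] at h1
  rw [← Finset.sum_mul, PMF.sum_coe_fintype, one_mul] at h1
  rw [← h1, ← mul_assoc, ENNReal.inv_mul_cancel (by simp) (ENNReal.natCast_ne_top _), one_mul]

end Averaging

/-! ### Random affine codes -/

section AffineCode

variable {F N : Type*} [Field F] [AddCommGroup N] [Module F N] {k : ℕ}

/-- The affine code with generators `g` and shift `s`. -/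
def affineCode (g : Fin k → N) (s : N) (m : Fin k → F) : N := ∑ i, m i • g i + s

theorem affineCode_add (g : Fin k → N) (s d e : N) (i : Fin k) (a : F) (m : Fin k → F) :
    affineCode (g + Pi.single i (a • d)) (s + e) m = affineCode g s m + ((m i * a) • d + e) := by
  have : ∑ j, m j • (Pi.single i (a • d) : Fin k → N) j = (m i * a) • d := by
    rw [Finset.sum_eq_single i]
    · rw [Pi.single_eq_same, smul_smul]
    · intro j _ hj
      rw [Pi.single_eq_of_ne hj, smul_zero]
    · simp
  simp only [affineCode, Pi.add_apply, smul_add, Finset.sum_add_distrib, this]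
  abel

variable [Fintype N]

theorem sum_affineCode (m : Fin k → F) (h : N → ℝ≥0∞) :
    (Fintype.card N : ℝ≥0∞) * ∑ ω : (Fin k → N) × N, h (affineCode ω.1 ω.2 m) =
      Fintype.card ((Fin k → N) × N) * ∑ x, h x := by
  rw [card_mul_sum_eq_sum_sum_shift _ fun e : N => ((0 : Fin k → N), e)]
  have : ∀ ω : (Fin k → N) × N, ∑ e, h (affineCode (ω + (0, e)).1 (ω + (0, e)).2 m) =
      ∑ x, h x := fun ω => by
    rw [← Equiv.sum_comp (Equiv.addLeft (affineCode ω.1 ω.2 m)) h]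
    refine Finset.sum_congr rfl fun e _ => ?_
    simp [affineCode]
  simp only [this, Finset.sum_const, Finset.card_univ, nsmul_eq_mul]

/-- The codewords of two different messages are independent and uniform in a random affine code. -/
theorem sum_affineCode_pair {m m' : Fin k → F} (hm : m ≠ m') (H : N → N → ℝ≥0∞) :
    (Fintype.card (N × N) : ℝ≥0∞) *
        ∑ ω : (Fin k → N) × N, H (affineCode ω.1 ω.2 m) (affineCode ω.1 ω.2 m') =
      Fintype.card ((Fin k → N) × N) * ∑ x, ∑ x', H x x' := by
  obtain ⟨i, hi⟩ := Function.ne_iff.1 hm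
  -- With this scaling, moving the i-th generator by `a • d` moves the codeword of m by exactly d
  -- more than that of m'.
  set a := (m i - m' i)⁻¹ with ha
  have ha1 : m i * a = m' i * a + 1 := by
    have := mul_inv_cancel₀ (sub_ne_zero.2 hi)
    rw [← ha] at this
    linear_combination this
  -- The shift is compensated so that the codeword of m' moves by `p.2` and that of m by `p.1 +
  -- p.2`; as p varies, the pair runs through all of N × N once.
  rw [card_mul_sum_eq_sum_sum_shift _
    fun p : N × N => ((Pi.single i (a • p.1) : Fin k → N), p.2 - (m' i * a) • p.1)]
  have : ∀ ω : (Fin k → N) × N, ∑ p : N × N,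
      H (affineCode (ω + ((Pi.single i (a • p.1) : Fin k → N), p.2 - (m' i * a) • p.1)).1
          (ω + ((Pi.single i (a • p.1) : Fin k → N), p.2 - (m' i * a) • p.1)).2 m)
        (affineCode (ω + ((Pi.single i (a • p.1) : Fin k → N), p.2 - (m' i * a) • p.1)).1
          (ω + ((Pi.single i (a • p.1) : Fin k → N), p.2 - (m' i * a) • p.1)).2 m') =
      ∑ x, ∑ x', H x x' := fun ω => by
    simp only [Prod.fst_add, Prod.snd_add, affineCode_add, ha1, add_smul, one_smul,
      Fintype.sum_prod_type]
    rw [Finset.sum_comm, Finset.sum_comm (f := fun x x' => H x x')]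
    symm
    rw [← Equiv.sum_comp (Equiv.addLeft (affineCode ω.1 ω.2 m'))]
    refine Finset.sum_congr rfl fun e _ => ?_
    rw [← Equiv.sum_comp (Equiv.addLeft (affineCode ω.1 ω.2 m + e))]
    refine Finset.sum_congr rfl fun d _ => ?_
    congr 1
    · simp only [Equiv.coe_addLeft]; abel
    · simp only [Equiv.coe_addLeft]; abel
  simp only [this, Finset.sum_const, Finset.card_univ, nsmul_eq_mul]

end AffineCode

/-- A decoder that outputs `m` on the points that lie in `E m` and in no other `E m'`. -/
theorem exists_decoder {M Z : Type*} [Finite M] [Nonempty M] [MeasurableSpace Z] (E : M → Set Z)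
    (hE : ∀ m, MeasurableSet (E m)) :
    ∃ dec : Z → M, (∀ m, MeasurableSet (dec ⁻¹' {m})) ∧
      ∀ m, {y | dec y ≠ m} ⊆ (E m)ᶜ ∪ ⋃ m' ∈ {m' | m' ≠ m}, E m' := by
  classical
  -- The decoder factors through the set of messages m with y in `E m`. There are finitely many such
  -- sets, which gives measurability.
  let D : Set M → M := fun T => if h : ∃ m, T = {m} then h.choose else Classical.arbitrary M
  have hD : ∀ m, D {m} = m := fun m => by
    have h : ∃ m', ({m} : Set M) = {m'} := ⟨m, rfl⟩
    simp only [D, dif_pos h]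
    exact (Set.singleton_injective h.choose_spec).symm
  refine ⟨fun y => D {m | y ∈ E m}, fun m => ?_, fun m y hy => ?_⟩
  · have : (fun y => D {m | y ∈ E m}) ⁻¹' {m} =
        ⋃ T ∈ {T : Set M | D T = m}, ⋂ m', {y | y ∈ E m' ↔ m' ∈ T} := by
      ext y
      simp only [Set.mem_preimage, Set.mem_singleton_iff, Set.mem_ofPred_eq, Set.mem_iUnion,
        Set.mem_iInter, exists_prop]
      refine ⟨fun h => ⟨_, h, fun _ => Iff.rfl⟩, ?_⟩
      rintro ⟨T, hT, h⟩
      rw [← hT]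
      congr 1
      ext m'
      exact h m'
    rw [this]
    refine MeasurableSet.biUnion (Set.to_countable _) fun T _ => MeasurableSet.iInter fun m' => ?_
    by_cases hm' : m' ∈ T
    · simpa [hm'] using hE m'
    · convert (hE m').compl using 1
      ext y
      simp [hm']
  · by_contra hcon
    simp only [Set.mem_union, Set.mem_compl_iff, Set.mem_iUnion, not_or, not_not, not_exists,
      Set.mem_ofPred_eq] at hcon hy
    refine hy ?_
    have : {m | y ∈ E m} = {m} := by
      ext m'
      refine ⟨fun h => ?_, fun h => ?_⟩
      · by_contra hne
        exact hcon.2 m' hne h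
      · rw [Set.mem_singleton_iff.1 h]
        exact hcon.1
    rw [this, hD]

/-! ### Existence of good affine codes -/

section RandomCoding

variable {F G Y : Type*} [Field F] [Fintype F] [AddCommGroup G] [Module F G] [Fintype G]
  [MeasurableSpace Y] {V : G → Measure Y} [∀ a, IsProbabilityMeasure (V a)]

/-- Random coding with affine codes. -/
theorem exists_affineCode_error_le {n k : ℕ} {γ τ : ℝ≥0∞} (hγ : γ ≠ 0) (hγ' : γ ≠ ∞)
    (hτ : ∀ x : Fin n → G, Measure.pi (fun t => V (x t))
      {y | blockDensity V (mixture (PMF.uniformOfFintype G) V) x y ≤ γ} ≤ τ) :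
    ∃ (g : Fin k → Fin n → G) (s : Fin n → G) (dec : (Fin n → Y) → (Fin k → F)),
      (∀ m, MeasurableSet (dec ⁻¹' {m})) ∧
      (Fintype.card (Fin k → F) : ℝ≥0∞)⁻¹ *
        ∑ m, Measure.pi (fun t => V (affineCode g s m t)) {y | dec y ≠ m} ≤
          τ + Fintype.card (Fin k → F) * γ⁻¹ := by
  classical
  set P := PMF.uniformOfFintype G with hP
  set κ := mixture P V with hκ
  have hac : ∀ a, V a ≪ κ := fun a =>
    Measure.absolutelyContinuous_of_le_smul (le_inv_smul_mixture P V (a := a) (by simp [hP]))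
  set N := Fin n → G
  set M := Fin k → F
  let E : N → Set (Fin n → Y) := fun x => {y | γ < blockDensity V κ x y}
  have hE : ∀ x, MeasurableSet (E x) := fun x =>
    measurableSet_lt measurable_const (measurable_blockDensity V κ x)
  let T : N → ℝ≥0∞ := fun x => Measure.pi (fun t => V (x t)) (E x)ᶜ
  let U : N → N → ℝ≥0∞ := fun x x' => Measure.pi (fun t => V (x t)) (E x')
  have hT : ∀ x, T x ≤ τ := fun x => by
    have : (E x)ᶜ = {y | blockDensity V κ x y ≤ γ} := by
      ext y
      simp [E]
    change Measure.pi _ (E x)ᶜ ≤ τ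
    rw [this]
    exact hτ x
  have hU : ∑ x, ∑ x', U x x' ≤ Fintype.card (N × N) * γ⁻¹ := by
    rw [Finset.sum_comm]
    have h1 : ∀ x', ∑ x, U x x' ≤ Fintype.card N * γ⁻¹ := fun x' => by
      -- Averaging over a uniform transmitted block replaces its output law by the product of copies
      -- of κ, where Markov's inequality bounds the test region of x'.
      have h2 := sum_prod_mul_pi P V n (E x')
      have h3 : ∀ x : N, ∏ t, P (x t) = (Fintype.card N : ℝ≥0∞)⁻¹ := fun x => by
        simp [hP, N, ENNReal.inv_pow]
      simp only [h3, ← Finset.mul_sum] at h2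
      have h4 := measure_lt_blockDensity_le_inv hac x' hγ hγ'
      change Measure.pi (fun _ => κ) (E x') ≤ _ at h4
      rw [← h2] at h4
      calc ∑ x, U x x' = Fintype.card N * ((Fintype.card N : ℝ≥0∞)⁻¹ * ∑ x, U x x') := by
            rw [← mul_assoc, ENNReal.mul_inv_cancel (by simp) (ENNReal.natCast_ne_top _), one_mul]
        _ ≤ _ := by gcongr
    calc _ ≤ ∑ _x' : N, (Fintype.card N : ℝ≥0∞) * γ⁻¹ := Finset.sum_le_sum fun x' _ => h1 x'
      _ = _ := by simp [mul_assoc]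
  let Ω := (Fin k → N) × N
  let B : Ω → ℝ≥0∞ := fun ω => ∑ m : M, (T (affineCode ω.1 ω.2 m) +
    ∑ m' : M, if m' = m then 0 else U (affineCode ω.1 ω.2 m) (affineCode ω.1 ω.2 m'))
  have hpair : ∀ m m' : M, ∑ ω : Ω, (if m' = m then 0 else
      U (affineCode ω.1 ω.2 m) (affineCode ω.1 ω.2 m')) ≤ Fintype.card Ω * γ⁻¹ := fun m m' => by
    by_cases h : m' = m
    · simp [h]
    simp only [h, if_false]
    have h1 := sum_affineCode_pair (Ne.symm h) U
    refine (ENNReal.mul_le_mul_iff_right (a := (Fintype.card (N × N) : ℝ≥0∞)) (by simp)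
      (ENNReal.natCast_ne_top _)).1 ?_
    rw [h1, mul_left_comm]
    gcongr
  have hB : ∑ ω : Ω, B ω ≤
      Fintype.card Ω * (Fintype.card M * (τ + Fintype.card M * γ⁻¹)) := by
    calc ∑ ω : Ω, B ω = ∑ m : M, (∑ ω : Ω, T (affineCode ω.1 ω.2 m) + ∑ m' : M, ∑ ω : Ω,
          (if m' = m then 0 else U (affineCode ω.1 ω.2 m) (affineCode ω.1 ω.2 m'))) := by
          rw [Finset.sum_comm]
          refine Finset.sum_congr rfl fun m _ => ?_
          rw [Finset.sum_add_distrib]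
          congr 1
          rw [Finset.sum_comm]
      _ ≤ ∑ m : M, (∑ _ω : Ω, τ + ∑ _m' : M, Fintype.card Ω * γ⁻¹) := by
          gcongr with m _ ω _ m'
          · exact hT _
          · exact hpair m m'
      _ = _ := by
          simp only [Finset.sum_const, Finset.card_univ, nsmul_eq_mul]
          ring
  obtain ⟨ω, hω⟩ := exists_le_sum_mul (PMF.uniformOfFintype Ω) B (PMF.sum_coe_fintype _)
  have hω' : B ω ≤ Fintype.card M * (τ + Fintype.card M * γ⁻¹) := by
    refine hω.trans ?_
    simp only [PMF.uniformOfFintype_apply, ← Finset.mul_sum]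
    calc _ ≤ (Fintype.card Ω : ℝ≥0∞)⁻¹ *
          (Fintype.card Ω * (Fintype.card M * (τ + Fintype.card M * γ⁻¹))) := by gcongr
      _ = _ := by
          rw [← mul_assoc, ENNReal.inv_mul_cancel (by simp) (ENNReal.natCast_ne_top _), one_mul]
  obtain ⟨dec, hdec, hsub⟩ := exists_decoder (fun m : M => E (affineCode ω.1 ω.2 m))
    fun m => hE _
  refine ⟨ω.1, ω.2, dec, hdec, ?_⟩
  have herr : ∑ m, Measure.pi (fun t => V (affineCode ω.1 ω.2 m t)) {y | dec y ≠ m} ≤ B ω := by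
    refine Finset.sum_le_sum fun m _ => ?_
    refine (measure_mono (hsub m)).trans ((measure_union_le _ _).trans ?_)
    refine add_le_add le_rfl ?_
    have : ⋃ m' ∈ {m' | m' ≠ m}, E (affineCode ω.1 ω.2 m') =
        ⋃ m' ∈ Finset.univ.filter (fun m' : M => m' ≠ m), E (affineCode ω.1 ω.2 m') := by
      ext y
      simp only [Set.mem_iUnion, Finset.mem_filter, Finset.mem_univ, true_and]
      rfl
    rw [this]
    refine (measure_biUnion_finset_le _ _).trans ?_
    rw [Finset.sum_filter]
    refine Finset.sum_le_sum fun m' _ => ?_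
    by_cases h : m' = m
    · simp [h]
    · simp only [h, ne_eq, not_false_eq_true, if_true, if_false]
      exact le_rfl
  calc _ ≤ (Fintype.card M : ℝ≥0∞)⁻¹ *
        (Fintype.card M * (τ + Fintype.card M * γ⁻¹)) := by gcongr; exact herr.trans hω'
    _ = _ := by
        rw [← mul_assoc, ENNReal.inv_mul_cancel (by simp) (ENNReal.natCast_ne_top _), one_mul]

end RandomCoding

/-! ### Consequences of symmetry -/

section Symmetric

theorem measure_eq_map_of_isSymmetricMAC {c : ℕ} {G Y : Type*} [AddCommGroup G] [AddAction G Y]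
    [MeasurableSpace Y] [MeasurableConstVAdd G Y] {W : (Fin c → G) → Measure Y}
    (hW : IsSymmetricMAC W) (x : Fin c → G) (i : Fin c) (a : G) :
    W (Function.update x i (x i + a)) = (W x).map (-a +ᵥ ·) := by
  ext B hB
  rw [← hW x i a B hB, Measure.map_apply (measurable_const_vadd (-a)) hB]
  congr 1
  exact AddAction.toPerm a |>.image_eq_preimage_symm B

theorem eq_map_sum_of_isSymmetricMAC {c : ℕ} {G Y : Type*} [AddCommGroup G] [AddAction G Y]
    [MeasurableSpace Y] [MeasurableConstVAdd G Y] {W : (Fin c → G) → Measure Y}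
    (hW : IsSymmetricMAC W) (x : Fin c → G) : W x = (W 0).map (-(∑ i, x i) +ᵥ ·) := by
  classical
  have key : ∀ s : Finset (Fin c), W (fun i => if i ∈ s then x i else 0) =
      (W 0).map (-(∑ i ∈ s, x i) +ᵥ ·) := fun s => by
    induction s using Finset.induction_on with
    | empty =>
      simp only [Finset.notMem_empty, if_false, Finset.sum_empty, neg_zero, zero_vadd,
        Measure.map_id']
      rfl
    | insert j s hj ih =>
      have h := measure_eq_map_of_isSymmetricMAC hW (fun i => if i ∈ s then x i else 0) j (x j)
      rw [ih, Measure.map_map (measurable_const_vadd _) (measurable_const_vadd _)] at h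
      have h1 : Function.update (fun i => if i ∈ s then x i else 0) j
          ((if j ∈ s then x j else 0) + x j) = fun i => if i ∈ insert j s then x i else 0 := by
        funext i
        by_cases hij : i = j
        · subst hij; simp [hj]
        · simp [hij]
      rw [h1] at h
      rw [h, Finset.sum_insert hj]
      congr 1
      funext y
      simp only [Function.comp_apply, vadd_vadd, neg_add]
  simpa using key Finset.univ

theorem sum_single {ι G : Type*} [Fintype ι] [DecidableEq ι] [AddCommMonoid G] (j : ι) (a : G) :
    ∑ i, (Pi.single j a : ι → G) i = a := by
  rw [Finset.sum_pi_single', if_pos (Finset.mem_univ j)]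

theorem eq_singleAccess_sum {c : ℕ} [NeZero c] {G Y : Type*} [AddCommGroup G] [AddAction G Y]
    [MeasurableSpace Y] [MeasurableConstVAdd G Y] {W : (Fin c → G) → Measure Y}
    (hW : IsSymmetricMAC W) (x : Fin c → G) : W x = singleAccess W (∑ i, x i) := by
  rw [singleAccess, eq_map_sum_of_isSymmetricMAC hW, eq_map_sum_of_isSymmetricMAC hW (Pi.single 0 _),
    sum_single]

theorem singleAccess_add {c : ℕ} [NeZero c] {G Y : Type*} [AddCommGroup G] [AddAction G Y]
    [MeasurableSpace Y] [MeasurableConstVAdd G Y] {W : (Fin c → G) → Measure Y}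
    (hW : IsSymmetricMAC W) (a b : G) :
    singleAccess W (a + b) = (singleAccess W a).map (-b +ᵥ ·) := by
  have := measure_eq_map_of_isSymmetricMAC hW (Pi.single 0 a) 0 b
  rw [singleAccess, singleAccess, ← this]
  congr 1
  funext i
  by_cases hi : i = 0
  · subst hi; simp
  · simp [hi]

/-- A translation carries `V b` to `V a` and fixes the uniform mixture, so data processing applies;
exchanging a and b gives equality. -/
theorem klDiv_singleAccess_le {c : ℕ} [NeZero c] {G Y : Type*} [AddCommGroup G] [Fintype G]
    [AddAction G Y] [MeasurableSpace Y] [MeasurableConstVAdd G Y] {W : (Fin c → G) → Measure Y}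
    [∀ x, IsProbabilityMeasure (W x)] (hW : IsSymmetricMAC W) (a b : G) :
    klDiv (singleAccess W a) (mixture (PMF.uniformOfFintype G) (singleAccess W)) ≤
      klDiv (singleAccess W b) (mixture (PMF.uniformOfFintype G) (singleAccess W)) := by
  have : ∀ x, IsProbabilityMeasure (singleAccess W x) := fun x => by
    rw [singleAccess]; infer_instance
  have hmeas : Measurable fun y : Y => -(a - b) +ᵥ y := measurable_const_vadd _
  have h1 : singleAccess W a = (singleAccess W b).map (-(a - b) +ᵥ ·) := by
    rw [← singleAccess_add hW, add_sub_cancel]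
  have h2 : mixture (PMF.uniformOfFintype G) (singleAccess W) =
      (mixture (PMF.uniformOfFintype G) (singleAccess W)).map (-(a - b) +ᵥ ·) := by
    ext B hB
    rw [Measure.map_apply hmeas hB, mixture_apply, mixture_apply]
    simp only [PMF.uniformOfFintype_apply, ← Finset.mul_sum]
    rw [← Equiv.sum_comp (Equiv.addRight (a - b))]
    congr 1
    refine Finset.sum_congr rfl fun x _ => ?_
    rw [← Measure.map_apply hmeas hB, ← singleAccess_add hW]
    rfl
  calc _ = klDiv ((singleAccess W b).map (-(a - b) +ᵥ ·))
        ((mixture (PMF.uniformOfFintype G) (singleAccess W)).map (-(a - b) +ᵥ ·)) := by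
        rw [← h1, ← h2]
    _ ≤ _ := klDiv_map_le _ _ hmeas

end Symmetric

/-! ### Sum codes against block codes -/

section SumChannel

variable {c : ℕ} [NeZero c] {G Y : Type*} [AddCommGroup G] [Fintype G] [MeasurableSpace Y]
  {V : G → Measure Y} {W : (Fin c → G) → Measure Y}

theorem PMF.sum_prod_coe {ι A : Type*} [Fintype ι] [DecidableEq ι] [Fintype A] (P : ι → PMF A) :
    ∑ x : ι → A, ∏ i, P i (x i) = 1 := by
  have := Finset.prod_univ_sum (fun _ : ι => (Finset.univ : Finset A)) fun i a => P i a
  rw [Fintype.piFinset_univ] at this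
  rw [← this]
  simp [PMF.sum_coe_fintype]

theorem exists_channelCode_error_le {F : Type*} [Field F] [Fintype F] {n k : ℕ}
    (hWV : ∀ x, W x = V (∑ i, x i)) (Φ : SumCode F G Y c n k) :
    ∃ Ψ : ChannelCode G Y n (Fintype.card (Fin k → F)), Ψ.error V ≤ Φ.error W := by
  classical
  have hx : ∀ m : Fin c → Fin k → F, ∃ x : Fin n → G,
      Measure.pi (fun t => V (x t)) {y | Φ.dec y ≠ ∑ i, m i} ≤
        Φ.output W m {y | Φ.dec y ≠ ∑ i, m i} := fun m => by
    obtain ⟨x, hx⟩ := exists_le_sum_mul (fun x : Fin c → Fin n → G => ∏ i, Φ.enc i (m i) (x i))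
      (fun x => Measure.pi (fun t => W (fun i => x i t)) {y | Φ.dec y ≠ ∑ i, m i})
      (PMF.sum_prod_coe _)
    refine ⟨fun t => ∑ i, x i t, ?_⟩
    simp only [hWV] at hx
    refine hx.trans (le_of_eq ?_)
    simp [SumCode.output, hWV]
  choose x hx using hx
  let e : (Fin c → Fin k → F) → ℝ≥0∞ := fun m => Φ.output W m {y | Φ.dec y ≠ ∑ i, m i}
  -- Fix the best message tuple m; only the shift a of sender 0's message remains as the message of
  -- the block code, whose decoder subtracts the known sum of m.
  obtain ⟨m, hm⟩ := exists_le_sum_mul (PMF.uniformOfFintype (Fin c → Fin k → F))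
    (fun m => (Fintype.card (Fin k → F) : ℝ≥0∞)⁻¹ * ∑ a : Fin k → F, e (m + Pi.single 0 a))
    (PMF.sum_coe_fintype _)
  have herr : ∑ m, PMF.uniformOfFintype (Fin c → Fin k → F) m *
      ((Fintype.card (Fin k → F) : ℝ≥0∞)⁻¹ * ∑ a : Fin k → F, e (m + Pi.single 0 a)) =
        Φ.error W := by
    have h1 := card_mul_sum_eq_sum_sum_shift e fun a : Fin k → F => Pi.single 0 a
    simp only [SumCode.error, PMF.uniformOfFintype_apply, ← Finset.mul_sum]
    rw [← h1, ← mul_assoc (Fintype.card (Fin k → F) : ℝ≥0∞)⁻¹,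
      ENNReal.inv_mul_cancel (by simp) (ENNReal.natCast_ne_top _), one_mul]
  rw [herr] at hm
  let b := Fintype.equivFin (Fin k → F)
  have hsum : ∀ a : Fin k → F, ∑ i, (m + (Pi.single 0 a : Fin c → Fin k → F)) i = ∑ i, m i + a := fun a => by
    simp only [Pi.add_apply, Finset.sum_add_distrib, sum_single]
  have hdec : ∀ (y : Fin n → Y) a,
      b (Φ.dec y - ∑ i, m i) = a ↔ Φ.dec y = ∑ i, (m + (Pi.single 0 (b.symm a) : Fin c → Fin k → F)) i := fun y a => by
    rw [hsum, ← Equiv.eq_symm_apply, sub_eq_iff_eq_add']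
  refine ⟨⟨fun a => x (m + Pi.single 0 (b.symm a)), fun y => b (Φ.dec y - ∑ i, m i),
    fun a => ?_⟩, ?_⟩
  · convert Φ.measurableSet_dec (∑ i, (m + (Pi.single 0 (b.symm a) : Fin c → Fin k → F)) i) using 1
    ext y
    simp only [Set.mem_preimage, Set.mem_singleton_iff]
    exact hdec y a
  · refine le_trans ?_ hm
    simp only [ChannelCode.error]
    gcongr
    rw [← Equiv.sum_comp b]
    refine Finset.sum_le_sum fun a _ => ?_
    simp only [ne_eq, hdec, Equiv.symm_apply_apply]
    exact hx _

theorem secureModuloSumCapacity_le_channelCapacity (hWV : ∀ x, W x = V (∑ i, x i)) :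
    secureModuloSumCapacity W ≤ channelCapacity V := by
  refine sSup_le ?_
  rintro R ⟨F, _, _, k, Φ, herr, -, rfl⟩
  choose Ψ hΨ using fun n => exists_channelCode_error_le hWV (Φ n)
  refine le_sSup ⟨fun n => Fintype.card (Fin (k n) → F), fun n => Fintype.card_pos, Ψ, ?_, ?_⟩
  · exact tendsto_of_tendsto_of_tendsto_of_le_of_le tendsto_const_nhds herr (fun _ => zero_le) hΨ
  · simp

theorem SumCode.output_of_pure {c : ℕ} {F X Y : Type*} [Fintype X] [MeasurableSpace Y] {n k : ℕ}
    (Φ : SumCode F X Y c n k)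
    (W : (Fin c → X) → Measure Y) (f : Fin c → (Fin k → F) → Fin n → X)
    (hf : ∀ i m, Φ.enc i m = PMF.pure (f i m)) (m : Fin c → Fin k → F) :
    Φ.output W m = Measure.pi (fun t => W (fun i => f i (m i) t)) := by
  classical
  rw [SumCode.output, Finset.sum_eq_single fun i => f i (m i)]
  · simp [hf]
  · intro x _ hx
    obtain ⟨i, hi⟩ := Function.ne_iff.1 hx
    rw [Finset.prod_eq_zero (Finset.mem_univ i), zero_smul]
    rw [hf, PMF.pure_apply, if_neg hi]
  · simp

theorem exists_sumCode {F : Type*} [Field F] [Fintype F] [Module F G]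
    [∀ a, IsProbabilityMeasure (V a)] (hWV : ∀ x, W x = V (∑ i, x i)) {n k : ℕ} {γ τ : ℝ≥0∞}
    (hγ : γ ≠ 0) (hγ' : γ ≠ ∞)
    (hτ : ∀ x : Fin n → G, Measure.pi (fun t => V (x t))
      {y | blockDensity V (mixture (PMF.uniformOfFintype G) V) x y ≤ γ} ≤ τ) :
    ∃ Φ : SumCode F G Y c n k, Φ.error W ≤ τ + Fintype.card (Fin k → F) * γ⁻¹ ∧
      ∀ J : Finset (Fin c), J ≠ Finset.univ → Φ.leakage W J = 0 := by
  classical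
  obtain ⟨g, s, dec, hdec, herr⟩ := exists_affineCode_error_le (F := F) (k := k) hγ hγ' hτ
  -- Generators are shared, but only sender 0 adds the shift, so that the total shift is s.
  let f : Fin c → (Fin k → F) → Fin n → G :=
    fun i m => ∑ j, m j • g j + (Pi.single 0 s : Fin c → Fin n → G) i
  let Φ : SumCode F G Y c n k := ⟨fun i m => PMF.pure (f i m), dec, hdec⟩
  have hout : ∀ m, Φ.output W m = Measure.pi (fun t => V (affineCode g s (∑ i, m i) t)) :=
    fun m => by
    rw [Φ.output_of_pure W f (fun _ _ => rfl)]
    congr 1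
    funext t
    rw [hWV, ← Finset.sum_apply]
    congr 2
    simp only [f, affineCode, Finset.sum_apply, Finset.sum_smul]
    rw [← Finset.sum_apply, Finset.sum_add_distrib, sum_single, Finset.sum_comm]
  refine ⟨Φ, ?_, fun J hJ => ?_⟩
  · refine le_trans (le_of_eq ?_) herr
    simp only [SumCode.error, hout]
    exact sum_uniform_mul_comp (fun m : Fin c → Fin k → F => ∑ i, m i) (fun a => Pi.single 0 a)
      (fun m a => by simp only [Pi.add_apply, Finset.sum_add_distrib, sum_single])
      fun a => Measure.pi (fun t => V (affineCode g s a t)) {y | dec y ≠ a}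
  · obtain ⟨j, hj⟩ : ∃ j, j ∉ J := by
      by_contra! h
      exact hJ (Finset.eq_univ_iff_forall.2 h)
    set ν : Measure (Fin n → Y) := mixture (PMF.uniformOfFintype (Fin k → F))
      (fun a => Measure.pi (fun t => V (affineCode g s a t))) with hν
    have hcond : ∀ z, Φ.condOutput W J z = ν := fun z => by
      ext B _
      rw [SumCode.condOutput, hν, mixture_apply, mixture_apply]
      simp only [hout]
      -- A sender j outside J has a uniform message, which makes the sum uniform whatever z is.
      refine (sum_uniform_mul_comp
        (fun m : Fin c → Fin k → F => ∑ i, if h : i ∈ J then z ⟨i, h⟩ else m i)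
        (fun a => Pi.single j a) (fun m a => ?_)
        fun a => Measure.pi (fun t => V (affineCode g s a t)) B).trans ?_
      · have : ∀ i, (if h : i ∈ J then z ⟨i, h⟩ else (m + (Pi.single j a : Fin c → Fin k → F)) i) =
            (if h : i ∈ J then z ⟨i, h⟩ else m i) + (Pi.single j a : Fin c → Fin k → F) i :=
          fun i => by
          by_cases h : i ∈ J
          · have hij : i ≠ j := fun h' => hj (h' ▸ h)
            simp [h, hij]
          · simp [h]
        simp only [this, Finset.sum_add_distrib, sum_single]
      · simp only [PMF.uniformOfFintype_apply, Finset.mul_sum]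
    have hmix : mixture (PMF.uniformOfFintype (J → Fin k → F)) (Φ.condOutput W J) = ν := by
      ext B _
      simp only [mixture_apply, hcond]
      rw [← Finset.sum_mul, PMF.sum_coe_fintype, one_mul]
    simp only [SumCode.leakage, mutualInfo, hmix, hcond]
    have : IsProbabilityMeasure ν := mixture.isProbabilityMeasure _ _
    simp [klDiv_self]

theorem le_secureModuloSumCapacity (F : Type) [Field F] [Fintype F] [Module F G]
    [∀ a, IsProbabilityMeasure (V a)] (hWV : ∀ x, W x = V (∑ i, x i)) {I : ℝ}
    (hI : ∀ a, (klDiv (V a) (mixture (PMF.uniformOfFintype G) V)).toReal = I) :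
    ENNReal.ofReal I ≤ secureModuloSumCapacity W := by
  set κ := mixture (PMF.uniformOfFintype G) V
  have hle : ∀ a, V a ≤ (Fintype.card G : ℝ≥0∞) • κ := fun a => by
    have := le_inv_smul_mixture (PMF.uniformOfFintype G) V (a := a) (by simp)
    simpa using this
  have hlog : 0 < Real.log (Fintype.card F) :=
    Real.log_pos (by exact_mod_cast Fintype.one_lt_card)
  have hmain : ∀ θ, θ < I → ENNReal.ofReal θ ≤ secureModuloSumCapacity W := by
    intro θ hθI
    rcases le_or_gt θ 0 with hθ0 | hθ0
    · simp [ENNReal.ofReal_of_nonpos hθ0]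
    obtain ⟨θ', hθ1, hθ2⟩ := exists_between hθI
    obtain ⟨τ, hτ, hτb⟩ := exists_tail_bound (ENNReal.natCast_ne_top _) hle hI hθ2.ne
    let k : ℕ → ℕ := fun n => ⌊θ / Real.log (Fintype.card F) * n⌋₊
    have hΦ : ∀ n, ∃ Φ : SumCode F G Y c n (k n),
        (0 < n → Φ.error W ≤ τ n +
          Fintype.card (Fin (k n) → F) * (ENNReal.ofReal (Real.exp (n * θ')))⁻¹) ∧
        ∀ J : Finset (Fin c), J ≠ Finset.univ → Φ.leakage W J = 0 := fun n => by
      have hγ : ENNReal.ofReal (Real.exp (n * θ')) ≠ 0 := by simp [Real.exp_pos]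
      rcases Nat.eq_zero_or_pos n with rfl | hn
      -- The tail bound needs n > 0; here only zero leakage matters, and τ = 1 is enough.
      · obtain ⟨Φ, -, h⟩ := exists_sumCode (F := F) (n := 0) (k := k 0) hWV hγ ENNReal.ofReal_ne_top
          fun x => prob_le_one
        exact ⟨Φ, fun h0 => absurd h0 (lt_irrefl _), h⟩
      · obtain ⟨Φ, h1, h⟩ := exists_sumCode (F := F) (n := n) (k := k n) hWV hγ
          ENNReal.ofReal_ne_top fun x => (hτb n hn x).1 hθ2
        exact ⟨Φ, fun _ => h1, h⟩
    choose Φ herr hleak using hΦ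
    refine le_sSup ⟨F, inferInstance, inferInstance, k, Φ, ?_, fun J _ hJ => ?_, ?_⟩
    · have hcard : ∀ n : ℕ,
          (Fintype.card (Fin (k n) → F) : ℝ≥0∞) * (ENNReal.ofReal (Real.exp (n * θ')))⁻¹ ≤
            ENNReal.ofReal (Real.exp (-((θ' - θ) * n))) := fun n => by
        rw [← ENNReal.ofReal_natCast, ← ENNReal.ofReal_inv_of_pos (Real.exp_pos _),
          ← ENNReal.ofReal_mul (by positivity)]
        refine ENNReal.ofReal_le_ofReal ?_
        have h1 : (Fintype.card (Fin (k n) → F) : ℝ) ≤ Real.exp (θ * n) := by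
          rw [Fintype.card_pi_const, Nat.cast_pow, ← Real.exp_log
            (show (0 : ℝ) < (Fintype.card F : ℝ) ^ k n by positivity), Real.log_pow,
            Real.exp_le_exp]
          calc (k n : ℝ) * Real.log (Fintype.card F) ≤
                (θ / Real.log (Fintype.card F) * n) * Real.log (Fintype.card F) := by
                gcongr
                exact Nat.floor_le (by positivity)
            _ = θ * n := by field_simp
        rw [← Real.exp_neg]
        calc _ ≤ Real.exp (θ * n) * Real.exp (-(n * θ')) := by gcongr
          _ = _ := by rw [← Real.exp_add]; congr 1; ring
      have hexp : Tendsto (fun n : ℕ => ENNReal.ofReal (Real.exp (-((θ' - θ) * n)))) atTop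
          (𝓝 0) := by
        rw [← ENNReal.ofReal_zero]
        refine ENNReal.tendsto_ofReal (Real.tendsto_exp_neg_atTop_nhds_zero.comp ?_)
        exact tendsto_natCast_atTop_atTop.const_mul_atTop (sub_pos.2 hθ1)
      have hadd := hτ.add hexp
      rw [add_zero] at hadd
      refine tendsto_of_tendsto_of_tendsto_of_le_of_le' tendsto_const_nhds hadd
        (Eventually.of_forall fun _ => zero_le) ?_
      filter_upwards [eventually_gt_atTop 0] with n hn
      exact (herr n hn).trans (by gcongr; exact hcard n)
    · simp [hleak _ J hJ]
    · refine (Tendsto.limsup_eq ?_).symm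
      refine ENNReal.tendsto_ofReal ?_
      have h1 : Tendsto (fun n : ℕ => (k n : ℝ) / n) atTop
          (𝓝 (θ / Real.log (Fintype.card F))) :=
        (tendsto_nat_floor_mul_div_atTop (by positivity)).comp tendsto_natCast_atTop_atTop
      have h2 := h1.mul_const (Real.log (Fintype.card F))
      rw [div_mul_cancel₀ _ hlog.ne'] at h2
      refine h2.congr fun n => ?_
      ring
  refine le_of_tendsto (x := 𝓝[<] I) (f := fun θ => ENNReal.ofReal θ)
    (ENNReal.continuous_ofReal.tendsto I |>.mono_left nhdsWithin_le_nhds) ?_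
  exact eventually_nhdsWithin_of_forall hmain

end SumChannel

/-! ### Closing the cycle of inequalities -/

theorem theorem1 {K : Type*} [Field K] [Fintype K] {c l : ℕ} [NeZero c]
    {Y : Type*} [MeasurableSpace Y]
    [AddAction (Fin l → K) Y] [MeasurableConstVAdd (Fin l → K) Y]
    (W : (Fin c → Fin l → K) → Measure Y) [∀ x, IsProbabilityMeasure (W x)]
    (hW : IsSymmetricMAC W) :
    secureModuloSumCapacity W = channelCapacity (singleAccess W) ∧
      channelCapacity (singleAccess W) = informationCapacity (singleAccess W) := by
  have hV : ∀ a, IsProbabilityMeasure (singleAccess W a) := fun a => by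
    rw [singleAccess]; infer_instance
  set P := PMF.uniformOfFintype (Fin l → K) with hP
  set V := singleAccess W
  set κ := mixture P V
  set I := (klDiv (V 0) κ).toReal with hI
  have hle : ∀ a, V a ≤ (P 0)⁻¹ • κ := fun a =>
    (le_inv_smul_mixture P V (a := a) (by simp [hP])).trans_eq (by simp [hP, κ])
  have hC : (P 0)⁻¹ ≠ ∞ := ENNReal.inv_ne_top.2 (by simp [hP])
  have hkl : ∀ a, klDiv (V a) κ = klDiv (V 0) κ := fun a =>
    le_antisymm (klDiv_singleAccess_le hW a 0) (klDiv_singleAccess_le hW 0 a)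
  have hklI : ∀ a, klDiv (V a) κ = ENNReal.ofReal I := fun a => by
    rw [hkl, hI, ENNReal.ofReal_toReal (klDiv_ne_top_of_le_smul hC (hle 0))]
  have hIa : ∀ a, (klDiv (V a) κ).toReal = I := fun a => by rw [hkl]
  -- The messages may live over the prime field, since the input alphabet is a vector space over it.
  obtain ⟨p, hp⟩ := CharP.exists K
  have : Fact p.Prime := ⟨(CharP.char_is_prime_or_zero K p).resolve_right
    (CharP.char_ne_zero_of_finite K p)⟩
  let _ : Algebra (ZMod p) K := ZMod.algebra K p
  have h1 := secureModuloSumCapacity_le_channelCapacity (eq_singleAccess_sum hW)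
  have h2 : channelCapacity V ≤ ENNReal.ofReal I := channelCapacity_le hC hle hIa
  have h3 : ENNReal.ofReal I ≤ secureModuloSumCapacity W :=
    le_secureModuloSumCapacity (ZMod p) (eq_singleAccess_sum hW) hIa
  have h4 : informationCapacity V = ENNReal.ofReal I := by
    refine le_antisymm (iSup_le fun Q => ?_) ?_
    · refine (mutualInfo_le_sum_klDiv Q V κ hC hle).trans (le_of_eq ?_)
      simp only [hklI, ← Finset.sum_mul, PMF.sum_coe_fintype, one_mul]
    · refine le_trans (le_of_eq ?_) (le_iSup _ P)
      change _ = ∑ a, P a * klDiv (V a) κ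
      simp only [hklI, ← Finset.sum_mul, PMF.sum_coe_fintype, one_mul]
  exact ⟨le_antisymm h1 (h2.trans h3), by
    rw [h4]; exact le_antisymm h2 (h3.trans h1)⟩
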